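/- **Setting.** Agents $i\in\mathcal M=\{1,\dots,m\}$ have convex objective functions $f_i:\mathbb R^n\to\mathbb R$ and constraint sets $X_i\subseteq\mathbb R^n$; $\|\cdot\|$ is the Euclidean norm and $P_{X}$ the Euclidean projection on a nonempty closed convex set $X$. Let $n(0),n(1),\dots$ be independent random elements of a measurable space $\Omega'$, defined on a probability space $(\Omega,\mathcal F,P)$, let $\psi:\mathbb R^{n\times m}\times\Omega'\to\mathbb R^{m\times m}$ be measurable, and let $\alpha(k)>0$ be stepsizes. The projected multi-agent subgradient algorithm starts at deterministic $x_i(0)\in X_i$ and, with $x(k)=(x_i(k))_{i\in\mathcal M}$, generates for all $k\ge0$ $$A(k)=[a_{ij}(k)]=\psi(x(k),n(k)),\qquad v_i(k)=\sum_{j=1}^m a_{ij}(k)x_j(k),\qquad x_i(k+1)=P_{X_i}\big[v_i(k)-\alpha(k)d_i(k)\big],$$ where $d_i(k)$ is a subgradient of $f_i$ at $v_i(k)$, selected as a measurable function of $n(0),\dots,n(k)$. Let $(\mathcal M,\mathcal E)$ be a directed graph and let $\gamma,K,C>0$ and $\delta\in(0,1]$ be constants such that for all $(j,i)\in\mathcal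 E$ and all $k\ge 0$ $$P\big(a_{ij}(k)\ge\gamma\,\big|\,x(k)=\overline x\big)\ \ge\ \min\Big\{\delta,\frac{K}{\|\overline x_i-\overline x_j\|^{C}}\Big\}\qquad\text{for almost every }\overline x\text{ with respect to the law of }x(k),$$ where the right-hand side is read as $\delta$ if $\overline x_i=\overline x_j$. **Assumptions.** 1. (Bounded subgradients) There is $L>0$ such that $\|s\|\le L$ for all $i\in\mathcal M$, $x\in\mathbb R^n$ and $s\in\partial f_i(x)$. 2. (Connectivity) $(\mathcal M,\mathcal E)$ is strongly connected. 3. (Doubly stochastic weights) For every $k\ge0$, $A(k)$ is doubly stochastic with probability one. 4. (Self confidence) $a_{ii}(k)\ge\gamma$ for all $i\in\mathcal M$ and $k\ge0$ with probability one. 5. (Identical constraint sets) $X_i=X$ for all $i$, for one closed convex set $X$. 6. (Limiting stepsizes) $\lim_{k\to\infty}k\,\log^p(k)\,\alpha(k)=0$ for every real $p<1$. **Proposition.** Under these assumptions, with $y(k)=\frac1m\sum_{j=1}^m x_j(k)$, for every agent $i$: (a) $\sum_{k=0}^\infty\alpha(k)\|x_i(k)-y(k)\|<\infty$ with probability one;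 (b) $\lim_{k\to\infty}\|x_i(k)-y(k)\|=0$ with probability one. -/

import Mathlib

open Set Filter Topology MeasureTheory ProbabilityTheory

/-- The state of the network: one estimate in `ℝⁿ` (Euclidean norm) for each of the `m` agents. -/
abbrev NetState (m n : ℕ) : Type := Fin m → EuclideanSpace ℝ (Fin n)

/-- The set of subgradients at `x` of a finite function `F` on `ℝⁿ`. -/
def subgradients {n : ℕ} (F : EuclideanSpace ℝ (Fin n) → ℝ) (x : EuclideanSpace ℝ (Fin n)) :
    Set (EuclideanSpace ℝ (Fin n)) :=
  {s | ∀ z, F x + inner ℝ s (z - x) ≤ F z}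

open Classical in
/-- The Euclidean projection of `u` on `X`: a point of `X` at minimal distance from `u`
(with value `u` if there is none). It is used for nonempty closed convex `X` only, where
the minimizer exists and is unique, see `euclProj_eq_iff`. -/
noncomputable def euclProj {n : ℕ} (X : Set (EuclideanSpace ℝ (Fin n)))
    (u : EuclideanSpace ℝ (Fin n)) : EuclideanSpace ℝ (Fin n) :=
  if h : ∃ p ∈ X, ∀ z ∈ X, ‖u - p‖ ≤ ‖u - z‖ then h.choose else u

theorem euclProj_spec {n : ℕ} {X : Set (EuclideanSpace ℝ (Fin n))} (hc : IsClosed X)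
    (hne : X.Nonempty) (u : EuclideanSpace ℝ (Fin n)) :
    euclProj X u ∈ X ∧ ∀ z ∈ X, ‖u - euclProj X u‖ ≤ ‖u - z‖ := by
  have h : ∃ p ∈ X, ∀ z ∈ X, ‖u - p‖ ≤ ‖u - z‖ := by
    obtain ⟨p, hp, hd⟩ := hc.exists_infDist_eq_dist hne u
    refine ⟨p, hp, fun z hz => ?_⟩
    rw [← dist_eq_norm, ← dist_eq_norm, ← hd]
    exact Metric.infDist_le_dist_of_mem hz
  unfold euclProj
  rw [dif_pos h]
  exact h.choose_spec

theorem euclProj_eq_iff {n : ℕ} {X : Set (EuclideanSpace ℝ (Fin n))} (hc : IsClosed X)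
    (hv : Convex ℝ X) (hne : X.Nonempty) (u p : EuclideanSpace ℝ (Fin n)) :
    euclProj X u = p ↔ p ∈ X ∧ ∀ z ∈ X, ‖u - p‖ ≤ ‖u - z‖ := by
  have key : ∀ q ∈ X, (∀ z ∈ X, ‖u - q‖ ≤ ‖u - z‖) → ∀ z ∈ X, inner ℝ (u - q) (z - q) ≤ 0 := by
    intro q hq hmin
    refine (norm_eq_iInf_iff_real_inner_le_zero hv hq).1 (le_antisymm ?_ ?_)
    · have : Nonempty X := hne.to_subtype
      exact le_ciInf fun z => hmin z z.2
    · exact ciInf_le ⟨0, by rintro _ ⟨z, rfl⟩; exact norm_nonneg _⟩ (⟨q, hq⟩ : X)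
  obtain ⟨hs, hmin⟩ := euclProj_spec hc hne u
  constructor
  · rintro rfl
    exact ⟨hs, hmin⟩
  · rintro ⟨hp, hpm⟩
    have h1 := key _ hs hmin p hp
    have h2 := key _ hp hpm _ hs
    rw [← sub_eq_zero, ← norm_eq_zero, ← sq_eq_zero_iff, ← real_inner_self_eq_norm_sq]
    set q := euclProj X u
    have e : inner ℝ (q - p) (q - p) = inner ℝ (u - q) (p - q) + inner ℝ (u - p) (q - p) := by
      rw [← neg_sub q p, inner_neg_right, neg_add_eq_sub, ← inner_sub_left]
      congr 1
      abel
    have := real_inner_self_nonneg (x := q - p)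
    linarith

/-- The convex combination `v_i = ∑_j a_ij x_j` that agent `i` forms of the estimates. -/
noncomputable def mixedEstimate {m n : ℕ} (a : Matrix (Fin m) (Fin m) ℝ) (x : NetState m n)
    (i : Fin m) : EuclideanSpace ℝ (Fin n) :=
  ∑ j, a i j • x j

/-- The average `(1/m) ∑_j x_j` of the agents' estimates. -/
noncomputable def averageEstimate {m n : ℕ} (x : NetState m n) : EuclideanSpace ℝ (Fin n) :=
  (1 / (m : ℝ)) • ∑ j, x j

/-- The information generated by the noise variables of the times `0, …, k`. -/
abbrev noiseHistory {Ω Ω' : Type*} [MeasurableSpace Ω'] (ξ : ℕ → Ω → Ω') (k : ℕ) :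
    MeasurableSpace Ω :=
  ⨆ j ≤ k, MeasurableSpace.comap (ξ j) inferInstance

/-- `x` (estimates), `A` (communication matrices) and `d` (subgradients) are generated by the
projected multi-agent subgradient algorithm with objective functions `f i`, constraint sets
`X i`, stepsizes `α k`, initial estimates `x₀`, and communication matrices
`A(k) = ψ (x(k), ξ(k))` driven by the noise `ξ`. Any selection of subgradients is allowed
that does not look into the future of the noise. -/
structure IsProjectedSubgradientMethod {m n : ℕ} {Ω Ω' : Type*} [MeasurableSpace Ω']
    (f : Fin m → EuclideanSpace ℝ (Fin n) → ℝ)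
    (X : Fin m → Set (EuclideanSpace ℝ (Fin n)))
    (α : ℕ → ℝ)
    (ψ : NetState m n → Ω' → Matrix (Fin m) (Fin m) ℝ)
    (ξ : ℕ → Ω → Ω')
    (x₀ : NetState m n)
    (x : ℕ → Ω → NetState m n)
    (A : ℕ → Ω → Matrix (Fin m) (Fin m) ℝ)
    (d : ℕ → Ω → NetState m n) : Prop where
  init_mem : ∀ i, x₀ i ∈ X i
  init_eq : ∀ ω, x 0 ω = x₀
  comm_eq : ∀ k ω, A k ω = ψ (x k ω) (ξ k ω)
  subgrad : ∀ k ω i, d k ω i ∈ subgradients (f i) (mixedEstimate (A k ω) (x k ω) i)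
  nonanticipating : ∀ k, Measurable[noiseHistory ξ k] (d k)
  update : ∀ k ω i,
    x (k + 1) ω i = euclProj (X i) (mixedEstimate (A k ω) (x k ω) i - α k • d k ω i)

/-- Bounded subgradients: one `L > 0` bounds all subgradients of all the `f i`. -/
def BoundedSubgradients {m n : ℕ} (f : Fin m → EuclideanSpace ℝ (Fin n) → ℝ) : Prop :=
  ∃ L : ℝ, 0 < L ∧ ∀ i x, ∀ s ∈ subgradients (f i) x, ‖s‖ ≤ L

/-- Strong connectivity: a directed path leads from every agent to every agent. -/
def StronglyConnectedDigraph {V : Type*} (G : Digraph V) : Prop :=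
  ∀ u v, Relation.ReflTransGen G.Adj u v

/-- The number `min {δ, K / r ^ C}`, where `K / 0 ^ C` is read as `+∞`. -/
noncomputable def commLowerBound (δ K C r : ℝ) : ℝ :=
  if r = 0 then δ else min δ (K / r ^ C)

/-- For every edge `(j, i)` of the graph and every time `k`, the conditional probability given
the state `x(k)` that `a_ij(k) ≥ γ` is at least `min {δ, K / ‖x_i(k) - x_j(k)‖ ^ C}`. -/
def DistanceDependentCommunication {m n : ℕ} {Ω : Type*} [MeasurableSpace Ω] (P : Measure Ω)
    (G : Digraph (Fin m)) (γ δ K C : ℝ)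
    (x : ℕ → Ω → NetState m n) (A : ℕ → Ω → Matrix (Fin m) (Fin m) ℝ) : Prop :=
  ∀ i j, G.Adj j i → ∀ k, ∀ᵐ ω ∂P,
    commLowerBound δ K C ‖x k ω i - x k ω j‖ ≤
      (P⟦{ω' | γ ≤ A k ω' i j} | MeasurableSpace.comap (x k) inferInstance⟧) ω

/-- The communication matrices are doubly stochastic with probability one. -/
def DoublyStochasticWeights {m : ℕ} {Ω : Type*} [MeasurableSpace Ω] (P : Measure Ω)
    (A : ℕ → Ω → Matrix (Fin m) (Fin m) ℝ) : Prop :=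
  ∀ k, ∀ᵐ ω ∂P, A k ω ∈ doublyStochastic ℝ (Fin m)

/-- Every agent gives weight at least `γ` to its own estimate, with probability one. -/
def SelfConfidence {m : ℕ} {Ω : Type*} [MeasurableSpace Ω] (P : Measure Ω) (γ : ℝ)
    (A : ℕ → Ω → Matrix (Fin m) (Fin m) ℝ) : Prop :=
  ∀ k i, ∀ᵐ ω ∂P, γ ≤ A k ω i i

/-- All agents have the same closed convex constraint set. -/
def IdenticalConstraintSets {m n : ℕ} (X : Fin m → Set (EuclideanSpace ℝ (Fin n))) : Prop :=
  ∃ Y : Set (EuclideanSpace ℝ (Fin n)), IsClosed Y ∧ Convex ℝ Y ∧ ∀ i, X i = Y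

/-- Limiting stepsizes: `k (log k)^p α(k) → 0` for every real `p < 1`. -/
def LimitingStepsizes (α : ℕ → ℝ) : Prop :=
  ∀ p : ℝ, p < 1 → Tendsto (fun k : ℕ => (k : ℝ) * Real.log k ^ p * α k) atTop (𝓝 0)

/-! Let `V k` be the sum of squared distances of the estimates from their average. Averaging with a
doubly stochastic matrix never increases it, and whenever an edge weight `a_ij` and the self weight
`a_ii` are both at least `γ` it drops by at least `γ / 2 * ‖x_i - x_j‖ ^ 2`
(`sum_norm_mixedEstimate_sub_sq_add_le`). Strong connectivity bounds `V` by a multiple of the edge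
energy, so mixing contracts the expected disagreement at a rate proportional to the communication
probability (`integral_sum_norm_mixedEstimate_sub_sq_le`).

That probability cannot decay fast: `α k ≤ c / (k + 1)` confines the estimates to deterministic
balls of logarithmic radius, so it is at least `q / √(k + 1)`. With `θ k` of that order, `E V (k +
1) ≤ (1 - θ k) * E V k + b k`, where the subgradient error `b k` is of order `α k ^ 2 / θ k`, hence
at most of order `k ^ (-3/2)`, which is summable. Telescoping gives `∑ θ k * E V k < ∞`, so `∑ θ k *
V k < ∞` almost surely.

Claim (a) follows from `α t ≤ α ^ 2 / θ + θ t ^ 2`. For (b), the increments of `V` are bounded above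
pathwise by a summable sequence, so `V` converges; since `∑ θ k = ∞`, the limit is zero. -/

/-! ### Variance inequalities for weighted averages. -/

section Geometry

variable {E : Type*} [NormedAddCommGroup E] [InnerProductSpace ℝ E]

/-- The variance identity for a weighted family of vectors. -/
theorem sum_mul_norm_sub_sq_eq {ι : Type*} [Fintype ι] (a : ι → ℝ) (ha : ∑ j, a j = 1)
    (u : ι → E) (z : E) :
    ∑ j, a j * ‖u j - z‖ ^ 2 =
      ∑ j, a j * ‖u j - ∑ l, a l • u l‖ ^ 2 + ‖(∑ l, a l • u l) - z‖ ^ 2 := by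
  set v := ∑ l, a l • u l with hv
  have h0 : ∑ j, a j * inner ℝ (u j - v) (v - z) = 0 := by
    have : ∑ j, a j • (u j - v) = 0 := by
      simp only [smul_sub, Finset.sum_sub_distrib, ← Finset.sum_smul, ha, one_smul, ← hv, sub_self]
    simp only [← real_inner_smul_left, ← sum_inner, this, inner_zero_left]
  have h1 : ∀ j, a j * ‖u j - z‖ ^ 2 =
      a j * ‖u j - v‖ ^ 2 + 2 * (a j * inner ℝ (u j - v) (v - z)) + a j * ‖v - z‖ ^ 2 := by
    intro j
    rw [← sub_add_sub_cancel (u j) v z, norm_add_sq_real]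
    ring
  simp only [h1, Finset.sum_add_distrib, ← Finset.mul_sum, h0, ← Finset.sum_mul, ha]
  ring

theorem norm_weighted_sum_sub_sq_le {ι : Type*} [Fintype ι] [DecidableEq ι] (a : ι → ℝ)
    (ha0 : ∀ j, 0 ≤ a j) (ha : ∑ j, a j = 1) (u : ι → E) (z : E) :
    ‖(∑ l, a l • u l) - z‖ ^ 2 ≤ ∑ j, a j * ‖u j - z‖ ^ 2 := by
  rw [sum_mul_norm_sub_sq_eq a ha]
  have : 0 ≤ ∑ j, a j * ‖u j - ∑ l, a l • u l‖ ^ 2 :=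
    Finset.sum_nonneg fun j _ => mul_nonneg (ha0 j) (sq_nonneg _)
  linarith

/-- In the variance identity the terms `i` and `j` alone contribute at least `γ` times the sum of
the squared distances of `u i` and `u j` from the mean, which is at least `γ / 2 * ‖u i - u j‖ ^ 2`.
-/
theorem norm_weighted_sum_sub_sq_add_le {ι : Type*} [Fintype ι] [DecidableEq ι] (a : ι → ℝ)
    (ha0 : ∀ j, 0 ≤ a j) (ha : ∑ j, a j = 1) (u : ι → E) (z : E) {γ : ℝ} (hγ : 0 ≤ γ) {i j : ι}
    (hi : γ ≤ a i) (hj : γ ≤ a j) :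
    ‖(∑ l, a l • u l) - z‖ ^ 2 + γ / 2 * ‖u i - u j‖ ^ 2 ≤ ∑ j, a j * ‖u j - z‖ ^ 2 := by
  rcases eq_or_ne i j with rfl | hij
  · simpa using norm_weighted_sum_sub_sq_le a ha0 ha u z
  rw [sum_mul_norm_sub_sq_eq a ha]
  set v := ∑ l, a l • u l
  have h1 : a i * ‖u i - v‖ ^ 2 + a j * ‖u j - v‖ ^ 2 ≤ ∑ l, a l * ‖u l - v‖ ^ 2 := by
    rw [← Finset.sum_pair (f := fun l => a l * ‖u l - v‖ ^ 2) hij]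
    exact Finset.sum_le_sum_of_subset_of_nonneg (Finset.subset_univ _)
      fun l _ _ => mul_nonneg (ha0 l) (sq_nonneg _)
  have h2 : ‖u i - u j‖ ^ 2 ≤ 2 * (‖u i - v‖ ^ 2 + ‖u j - v‖ ^ 2) := by
    have h3 : ‖u i - u j‖ ≤ ‖u i - v‖ + ‖u j - v‖ := by
      rw [← sub_sub_sub_cancel_right (u i) (u j) v]
      exact norm_sub_le _ _
    nlinarith [sq_nonneg (‖u i - v‖ - ‖u j - v‖), norm_nonneg (u i - u j)]
  have h4 := mul_le_mul_of_nonneg_right hi (sq_nonneg ‖u i - v‖)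
  have h5 := mul_le_mul_of_nonneg_right hj (sq_nonneg ‖u j - v‖)
  have h6 := mul_le_mul_of_nonneg_left h2 hγ
  linarith

/-- Young's inequality with free parameter `θ`: the factor `1 + θ` can be made small enough to be
absorbed by the contraction. -/
theorem sum_norm_sub_sq_le_of_norm_sub_le {ι E : Type*} [Fintype ι] [NormedAddCommGroup E] (u v : ι → E) (z : E) {ε θ : ℝ}
    (hθ : 0 < θ) (h : ∀ i, ‖u i - v i‖ ≤ ε) :
    ∑ i, ‖u i - z‖ ^ 2 ≤
      (1 + θ) * ∑ i, ‖v i - z‖ ^ 2 + (1 + 1 / θ) * (Fintype.card ι * ε ^ 2) := by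
  have key : ∀ i, ‖u i - z‖ ^ 2 ≤ (1 + θ) * ‖v i - z‖ ^ 2 + (1 + 1 / θ) * ε ^ 2 := by
    intro i
    have h1 : ‖u i - z‖ ≤ ‖v i - z‖ + ε := by
      rw [← sub_add_sub_cancel (u i) (v i) z]
      linarith [norm_add_le (u i - v i) (v i - z), h i]
    have h2 : ‖u i - z‖ ^ 2 ≤ (‖v i - z‖ + ε) ^ 2 := pow_le_pow_left₀ (norm_nonneg _) h1 2
    have h3 : (1 + θ) * ‖v i - z‖ ^ 2 + (1 + 1 / θ) * ε ^ 2 - (‖v i - z‖ + ε) ^ 2 =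
        (θ * ‖v i - z‖ - ε) ^ 2 / θ := by
      field_simp
      ring
    have h4 : 0 ≤ (θ * ‖v i - z‖ - ε) ^ 2 / θ := by positivity
    linarith
  calc _ ≤ ∑ i, ((1 + θ) * ‖v i - z‖ ^ 2 + (1 + 1 / θ) * ε ^ 2) :=
        Finset.sum_le_sum fun i _ => key i
    _ = _ := by
        rw [Finset.sum_add_distrib, ← Finset.mul_sum, Finset.sum_const, Finset.card_univ,
          nsmul_eq_mul]
        ring

end Geometry

/-! ### Euclidean projection on a closed convex set. -/

section Projection

variable {n : ℕ} {X : Set (EuclideanSpace ℝ (Fin n))}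

theorem inner_sub_euclProj_nonpos (hc : IsClosed X) (hv : Convex ℝ X) (hne : X.Nonempty)
    (u : EuclideanSpace ℝ (Fin n)) {z : EuclideanSpace ℝ (Fin n)} (hz : z ∈ X) :
    inner ℝ (u - euclProj X u) (z - euclProj X u) ≤ 0 := by
  obtain ⟨hs, hmin⟩ := euclProj_spec hc hne u
  refine (norm_eq_iInf_iff_real_inner_le_zero hv hs).1 (le_antisymm ?_ ?_) z hz
  · have : Nonempty X := hne.to_subtype
    exact le_ciInf fun z => hmin z z.2
  · exact ciInf_le ⟨0, by rintro _ ⟨z, rfl⟩; exact norm_nonneg _⟩ (⟨_, hs⟩ : X)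

theorem norm_euclProj_sub_le (hc : IsClosed X) (hv : Convex ℝ X) (hne : X.Nonempty)
    (u w : EuclideanSpace ℝ (Fin n)) : ‖euclProj X u - euclProj X w‖ ≤ ‖u - w‖ := by
  have h1 := inner_sub_euclProj_nonpos hc hv hne u (euclProj_spec hc hne w).1
  have h2 := inner_sub_euclProj_nonpos hc hv hne w (euclProj_spec hc hne u).1
  set p := euclProj X u
  set q := euclProj X w
  have e : inner ℝ (u - w) (p - q) =
      inner ℝ (p - q) (p - q) - inner ℝ (u - p) (q - p) - inner ℝ (w - q) (p - q) := by
    rw [← neg_sub p q, inner_neg_right, sub_neg_eq_add, ← inner_add_left, ← inner_sub_left]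
    congr 1
    abel
  have h3 := real_inner_le_norm (u - w) (p - q)
  rw [real_inner_self_eq_norm_sq] at e
  by_contra! h
  nlinarith [norm_nonneg (u - w)]

theorem continuous_euclProj (hc : IsClosed X) (hv : Convex ℝ X) (hne : X.Nonempty) :
    Continuous (euclProj X) :=
  (LipschitzWith.of_dist_le_mul (K := 1) fun u w => by
    simpa [dist_eq_norm] using norm_euclProj_sub_le hc hv hne u w).continuous

theorem norm_euclProj_sub_le_of_mem (hc : IsClosed X) {v : EuclideanSpace ℝ (Fin n)} (hv : v ∈ X)
    (u : EuclideanSpace ℝ (Fin n)) : ‖euclProj X u - v‖ ≤ 2 * ‖u - v‖ := by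
  have h := (euclProj_spec hc ⟨v, hv⟩ u).2 v hv
  have h1 : ‖euclProj X u - v‖ ≤ ‖u - v‖ + ‖u - euclProj X u‖ := by
    rw [← sub_sub_sub_cancel_left v (euclProj X u) u]
    exact norm_sub_le _ _
  linarith

end Projection

/-! ### Disagreement, mixing and edge energy. -/

section Disagreement

variable {m n : ℕ}

/-- The sum of the squared distances of the estimates from their average. -/
noncomputable def disagreement (x : NetState m n) : ℝ :=
  ∑ i, ‖x i - averageEstimate x‖ ^ 2

theorem disagreement_nonneg (x : NetState m n) : 0 ≤ disagreement x :=
  Finset.sum_nonneg fun _ _ => sq_nonneg _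

theorem norm_sub_averageEstimate_sq_le (x : NetState m n) (i : Fin m) :
    ‖x i - averageEstimate x‖ ^ 2 ≤ disagreement x :=
  Finset.single_le_sum (f := fun i => ‖x i - averageEstimate x‖ ^ 2)
    (fun _ _ => sq_nonneg _) (Finset.mem_univ i)

theorem disagreement_le_sum_norm_sub_sq (x : NetState m n) (z : EuclideanSpace ℝ (Fin n)) :
    disagreement x ≤ ∑ i, ‖x i - z‖ ^ 2 := by
  rcases Nat.eq_zero_or_pos m with rfl | hm
  · simp [disagreement]
  have hm' : (0 : ℝ) < m := by exact_mod_cast hm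
  have h := sum_mul_norm_sub_sq_eq (fun _ : Fin m => 1 / (m : ℝ)) (by simp [hm'.ne']) x z
  simp only [← Finset.mul_sum, ← Finset.smul_sum] at h
  change _ = 1 / (m : ℝ) * disagreement x + _ at h
  have h1 : 1 / (m : ℝ) * disagreement x ≤ 1 / m * ∑ i, ‖x i - z‖ ^ 2 := by
    rw [h]
    exact le_add_of_nonneg_right (sq_nonneg _)
  exact le_of_mul_le_mul_left h1 (by positivity)

/-- Row sums equal to one give the variance bound in each row, with a gain in row `i`; column sums
equal to one make the row bounds add up to the right-hand side. -/
theorem sum_norm_mixedEstimate_sub_sq_add_le {A : Matrix (Fin m) (Fin m) ℝ}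
    (hA : A ∈ doublyStochastic ℝ (Fin m)) (x : NetState m n) (z : EuclideanSpace ℝ (Fin n))
    {γ : ℝ} (hγ : 0 ≤ γ) {i : Fin m} (hi : γ ≤ A i i) (j : Fin m) :
    ∑ l, ‖mixedEstimate A x l - z‖ ^ 2 +
        γ / 2 * ({a | γ ≤ a}.indicator (fun _ => ‖x i - x j‖ ^ 2) (A i j)) ≤
      ∑ l, ‖x l - z‖ ^ 2 := by
  have h0 : ∀ i j, 0 ≤ A i j := fun i j => nonneg_of_mem_doublyStochastic hA
  have hrow := sum_row_of_mem_doublyStochastic hA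
  have hcol : ∑ l, ∑ k, A l k * ‖x k - z‖ ^ 2 = ∑ k, ‖x k - z‖ ^ 2 := by
    rw [Finset.sum_comm]
    simp [← Finset.sum_mul, sum_col_of_mem_doublyStochastic hA]
  rw [← hcol, ← Finset.add_sum_erase _ _ (Finset.mem_univ i),
    ← Finset.add_sum_erase _ _ (Finset.mem_univ i), add_right_comm]
  refine add_le_add ?_ (Finset.sum_le_sum fun l _ =>
    norm_weighted_sum_sub_sq_le (A l) (h0 l) (hrow l) x z)
  by_cases hj : γ ≤ A i j
  · rw [Set.indicator_of_mem (by exact hj)]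
    exact norm_weighted_sum_sub_sq_add_le (A i) (h0 i) (hrow i) x z hγ hi hj
  · rw [Set.indicator_of_notMem (by exact hj), mul_zero, add_zero]
    exact norm_weighted_sum_sub_sq_le (A i) (h0 i) (hrow i) x z

theorem norm_mixedEstimate_le {A : Matrix (Fin m) (Fin m) ℝ}
    (hA : A ∈ doublyStochastic ℝ (Fin m)) {x : NetState m n} {R : ℝ} (hx : ∀ i, ‖x i‖ ≤ R)
    (i : Fin m) : ‖mixedEstimate A x i‖ ≤ R := by
  have h := (convex_closedBall (0 : EuclideanSpace ℝ (Fin n)) R).sum_mem (t := Finset.univ)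
    (w := A i) (z := x) (fun j _ => nonneg_of_mem_doublyStochastic hA)
    (sum_row_of_mem_doublyStochastic hA i) (fun j _ => by simpa using hx j)
  exact mem_closedBall_zero_iff.1 h

theorem mixedEstimate_mem {A : Matrix (Fin m) (Fin m) ℝ}
    (hA : A ∈ doublyStochastic ℝ (Fin m)) {x : NetState m n}
    {X : Set (EuclideanSpace ℝ (Fin n))} (hX : Convex ℝ X) (hx : ∀ i, x i ∈ X)
    (i : Fin m) : mixedEstimate A x i ∈ X :=
  hX.sum_mem (fun _ _ => nonneg_of_mem_doublyStochastic hA)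
    (sum_row_of_mem_doublyStochastic hA i) (fun j _ => hx j)

open Classical in
/-- The sum of the squared differences of the estimates along the edges of a digraph. -/
noncomputable def edgeEnergy (G : Digraph (Fin m)) (x : NetState m n) : ℝ :=
  ∑ p : Fin m × Fin m with G.Adj p.2 p.1, ‖x p.1 - x p.2‖ ^ 2

theorem norm_sub_sq_le_edgeEnergy {G : Digraph (Fin m)} {i j : Fin m} (h : G.Adj j i)
    (x : NetState m n) : ‖x i - x j‖ ^ 2 ≤ edgeEnergy G x := by
  classical
  exact Finset.single_le_sum (f := fun p : Fin m × Fin m => ‖x p.1 - x p.2‖ ^ 2)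
    (fun _ _ => sq_nonneg _) (a := (i, j)) (by simpa using h)

theorem exists_norm_sub_le_mul_sqrt_edgeEnergy {G : Digraph (Fin m)} {u v : Fin m}
    (h : Relation.ReflTransGen G.Adj u v) :
    ∃ N : ℕ, ∀ x : NetState m n, ‖x u - x v‖ ≤ N * √(edgeEnergy G x) := by
  induction h with
  | refl => exact ⟨0, by simp⟩
  | @tail b c _ hbc ih =>
    obtain ⟨N, hN⟩ := ih
    refine ⟨N + 1, fun x => ?_⟩
    have h1 : ‖x b - x c‖ ≤ √(edgeEnergy G x) := by
      rw [norm_sub_rev]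
      exact Real.le_sqrt_of_sq_le (norm_sub_sq_le_edgeEnergy hbc x)
    have h2 := norm_sub_le_norm_sub_add_norm_sub (x u) (x b) (x c)
    push_cast
    linarith [hN x]

/-- The average minimizes the sum of squared distances, so it may be replaced by the estimate of one
fixed agent, to which every agent is joined by a path; the triangle inequality along the path does
the rest. -/
theorem exists_disagreement_le_mul_edgeEnergy {G : Digraph (Fin m)}
    (hG : StronglyConnectedDigraph G) :
    ∃ N : ℝ, 0 < N ∧ ∀ x : NetState m n, disagreement x ≤ N * edgeEnergy G x := by
  rcases Nat.eq_zero_or_pos m with rfl | hm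
  · exact ⟨1, one_pos, fun x => by simp [disagreement, edgeEnergy]⟩
  choose N hN using fun i => exists_norm_sub_le_mul_sqrt_edgeEnergy (n := n) (hG i ⟨0, hm⟩)
  refine ⟨∑ i, (N i : ℝ) ^ 2 + 1, by positivity, fun x => ?_⟩
  have hE : 0 ≤ edgeEnergy G x := Finset.sum_nonneg fun _ _ => sq_nonneg _
  calc disagreement x ≤ ∑ i, ‖x i - x ⟨0, hm⟩‖ ^ 2 := disagreement_le_sum_norm_sub_sq _ _
    _ ≤ ∑ i, (N i : ℝ) ^ 2 * edgeEnergy G x := by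
        refine Finset.sum_le_sum fun i _ => ?_
        have := pow_le_pow_left₀ (norm_nonneg _) (hN i x) 2
        rwa [mul_pow, Real.sq_sqrt hE] at this
    _ ≤ _ := by
        rw [← Finset.sum_mul, add_mul]
        linarith

end Disagreement

/-! ### Deterministic recursions and growth rates. -/

section Sequences

theorem summable_mul_of_le_one_sub_mul_add {w θ b : ℕ → ℝ} (hw : ∀ k, 0 ≤ w k) (hθ : ∀ k, 0 ≤ θ k)
    (hb0 : ∀ k, 0 ≤ b k) (hb : Summable b) (h : ∀ k, w (k + 1) ≤ (1 - θ k) * w k + b k) :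
    Summable fun k => θ k * w k := by
  refine summable_of_sum_range_le (c := w 0 + ∑' k, b k)
    (fun k => mul_nonneg (hθ k) (hw k)) fun N => ?_
  have key : ∀ N, w N + ∑ k ∈ Finset.range N, θ k * w k ≤ w 0 + ∑ k ∈ Finset.range N, b k := by
    intro N
    induction N with
    | zero => simp
    | succ N ih =>
      rw [Finset.sum_range_succ, Finset.sum_range_succ]
      linarith [h N]
  have h1 := hb.sum_le_tsum (Finset.range N) fun k _ => hb0 k
  linarith [key N, hw N]

/-- Subtracting the partial sums of `b` makes `u` antitone and bounded below, so `u` converges. A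
positive limit `ℓ` would give `θ k ≤ 2 / ℓ * (θ k * u k)` eventually, making `θ` summable. -/
theorem tendsto_zero_of_le_add_of_summable_mul {u θ b : ℕ → ℝ} (hu : ∀ k, 0 ≤ u k)
    (hθ : ∀ k, 0 ≤ θ k) (hb : Summable b) (h : ∀ k, u (k + 1) ≤ u k + b k)
    (hθu : Summable fun k => θ k * u k) (hθ' : ¬ Summable θ) : Tendsto u atTop (𝓝 0) := by
  have hB := hb.hasSum.tendsto_sum_nat
  have hanti : Antitone fun k => u k - ∑ l ∈ Finset.range k, b l := by
    refine antitone_nat_of_succ_le fun k => ?_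
    rw [Finset.sum_range_succ]
    linarith [h k]
  obtain ⟨c, hc⟩ := hB.bddAbove_range
  have hbdd : BddBelow (range fun k => u k - ∑ l ∈ Finset.range k, b l) := by
    refine ⟨-c, ?_⟩
    rintro _ ⟨k, rfl⟩
    have := hc ⟨k, rfl⟩
    simp only at this ⊢
    linarith [hu k]
  have hlim := (tendsto_atTop_ciInf hanti hbdd).add hB
  simp only [sub_add_cancel] at hlim
  set ℓ := (⨅ i, (u i - ∑ l ∈ Finset.range i, b l)) + ∑' k, b k
  have hℓ : 0 ≤ ℓ := ge_of_tendsto' hlim hu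
  rcases hℓ.eq_or_lt with h0 | hpos
  · rwa [← h0] at hlim
  exfalso
  obtain ⟨N, hN⟩ := eventually_atTop.1 (hlim.eventually_const_lt (half_lt_self hpos))
  refine hθ' ((summable_nat_add_iff N).1 ?_)
  refine Summable.of_nonneg_of_le (fun k => hθ _) (fun k => ?_)
    (((summable_nat_add_iff N).2 hθu).mul_left (2 / ℓ))
  have := mul_le_mul_of_nonneg_left (hN (k + N) (Nat.le_add_left _ _)).le (hθ (k + N))
  rw [div_mul_eq_mul_div, le_div_iff₀ hpos]
  linarith

theorem exists_le_div_of_tendsto_mul {α : ℕ → ℝ}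
    (h : Tendsto (fun k : ℕ => (k : ℝ) * α k) atTop (𝓝 0)) :
    ∃ c : ℝ, 0 < c ∧ ∀ k : ℕ, α k ≤ c / (k + 1) := by
  obtain ⟨c, hc⟩ := h.bddAbove_range
  have hc' : ∀ k : ℕ, (k : ℝ) * α k ≤ c := fun k => hc ⟨k, rfl⟩
  -- `2 * |c|` serves `k ≥ 1`, where `k + 1 ≤ 2 * k`; `|α 0|` serves `k = 0`.
  refine ⟨2 * |c| + |α 0| + 1, by positivity, fun k => ?_⟩
  rw [le_div_iff₀ (by positivity)]
  rcases Nat.eq_zero_or_pos k with rfl | hk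
  · simp only [Nat.cast_zero, zero_add, mul_one]
    linarith [le_abs_self (α 0), abs_nonneg c]
  have hk' : (1 : ℝ) ≤ k := by exact_mod_cast hk
  rcases le_total (α k) 0 with hα | hα
  · have : α k * (k + 1) ≤ 0 := mul_nonpos_of_nonpos_of_nonneg hα (by positivity)
    have := abs_nonneg c
    have := abs_nonneg (α 0)
    linarith
  · nlinarith [hc' k, le_abs_self c, abs_nonneg (α 0), abs_nonneg c]

/-- Partial sums of a sequence of order `1 / k` grow more slowly than every power of `k`. -/
theorem exists_add_sum_range_le_mul_rpow {α : ℕ → ℝ} {c : ℝ} (hc : 0 < c)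
    (h : ∀ k : ℕ, α k ≤ c / (k + 1)) {ε : ℝ} (hε : 0 < ε) (R : ℝ) :
    ∃ B : ℝ, 0 < B ∧ ∀ k : ℕ, R + ∑ l ∈ Finset.range k, α l ≤ B * ((k : ℝ) + 1) ^ ε := by
  refine ⟨|R| + c * (1 + 1 / ε), by positivity, fun k => ?_⟩
  have h1 : ∑ l ∈ Finset.range k, α l ≤ c * (1 + Real.log k) := by
    calc _ ≤ ∑ l ∈ Finset.range k, c / ((l : ℝ) + 1) := Finset.sum_le_sum fun l _ => h l
      _ = c * (harmonic k : ℝ) := by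
          rw [harmonic, Rat.cast_sum, Finset.mul_sum]
          refine Finset.sum_congr rfl fun l _ => ?_
          push_cast
          rw [div_eq_mul_inv]
      _ ≤ _ := mul_le_mul_of_nonneg_left (harmonic_le_one_add_log k) hc.le
  have h2 : (1 : ℝ) ≤ ((k : ℝ) + 1) ^ ε :=
    Real.one_le_rpow (by linarith [(Nat.cast_nonneg k : (0 : ℝ) ≤ k)]) hε.le
  have h3 : Real.log k ≤ ((k : ℝ) + 1) ^ ε / ε :=
    (Real.log_le_rpow_div (Nat.cast_nonneg k) hε).trans
      (div_le_div_of_nonneg_right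
        (Real.rpow_le_rpow (Nat.cast_nonneg k) (by linarith) hε.le) hε.le)
  have h4 : R ≤ |R| * ((k : ℝ) + 1) ^ ε := by
    nlinarith [le_abs_self R, abs_nonneg R]
  have h5 : 1 + Real.log k ≤ (1 + 1 / ε) * ((k : ℝ) + 1) ^ ε := by
    rw [add_mul, one_div_mul_eq_div, one_mul]
    linarith
  have h6 := mul_le_mul_of_nonneg_left h5 hc.le
  calc _ ≤ |R| * ((k : ℝ) + 1) ^ ε + c * ((1 + 1 / ε) * ((k : ℝ) + 1) ^ ε) := by linarith
    _ = _ := by ring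

/-- The exponent `1 / (2 * C)` is chosen so that `r ^ C` is at most of order `√(k + 1)`: slow enough
for non-summable rates, yet leaving `α k ^ 2 / θ k` summable. -/
theorem exists_div_sqrt_le_commLowerBound {δ K C B : ℝ} (hδ : 0 < δ) (hK : 0 < K) (hC : 0 < C)
    (hB : 0 < B) :
    ∃ q : ℝ, 0 < q ∧ ∀ (k : ℕ) (r : ℝ), 0 ≤ r → r ≤ B * ((k : ℝ) + 1) ^ (1 / (2 * C)) →
      q / √((k : ℝ) + 1) ≤ commLowerBound δ K C r := by
  have hBC : 0 < B ^ C := Real.rpow_pos_of_pos hB C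
  refine ⟨min δ (K / B ^ C), lt_min hδ (by positivity), fun k r hr0 hr => ?_⟩
  have hk : (0 : ℝ) ≤ k := Nat.cast_nonneg k
  have hs : 1 ≤ √((k : ℝ) + 1) := Real.one_le_sqrt.2 (by linarith)
  have hq : 0 < min δ (K / B ^ C) := lt_min hδ (by positivity)
  have h1 : min δ (K / B ^ C) / √((k : ℝ) + 1) ≤ δ :=
    (div_le_self hq.le hs).trans (min_le_left _ _)
  unfold commLowerBound
  split_ifs with h0
  · exact h1
  refine le_min h1 ?_
  have hrpos : 0 < r := lt_of_le_of_ne hr0 (Ne.symm h0)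
  have h2 : r ^ C ≤ B ^ C * √((k : ℝ) + 1) := by
    calc r ^ C ≤ (B * ((k : ℝ) + 1) ^ (1 / (2 * C))) ^ C := Real.rpow_le_rpow hr0 hr hC.le
      _ = _ := by
        rw [Real.mul_rpow hB.le (by positivity), ← Real.rpow_mul (by positivity), Real.sqrt_eq_rpow]
        congr 2
        field_simp
  calc _ ≤ K / B ^ C / √((k : ℝ) + 1) := by gcongr; exact min_le_right _ _
    _ = K / (B ^ C * √((k : ℝ) + 1)) := by rw [div_div]
    _ ≤ _ := div_le_div_of_nonneg_left hK.le (Real.rpow_pos_of_pos hrpos C) h2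

theorem not_summable_div_sqrt {c : ℝ} (hc : 0 < c) :
    ¬ Summable fun k : ℕ => c / √((k : ℝ) + 1) := by
  intro h
  have h1 : Summable fun k : ℕ => 1 / ((k + 1 : ℕ) : ℝ) ^ (1 / 2 : ℝ) := by
    refine (h.mul_left (1 / c)).congr fun k => ?_
    rw [← Real.sqrt_eq_rpow]
    push_cast
    field_simp
  have := (summable_nat_add_iff (f := fun k : ℕ => 1 / (k : ℝ) ^ (1 / 2 : ℝ)) 1).1 h1
  rw [Real.summable_one_div_nat_rpow] at this
  norm_num at this

theorem summable_sq_div_of_le {α : ℕ → ℝ} (hα : ∀ k, 0 ≤ α k) {c : ℝ}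
    (h : ∀ k : ℕ, α k ≤ c / (k + 1)) {q : ℝ} (hq : 0 < q) :
    Summable fun k : ℕ => α k ^ 2 / (q / √((k : ℝ) + 1)) := by
  have h1 : Summable fun k : ℕ => c ^ 2 / q * (1 / ((k + 1 : ℕ) : ℝ) ^ (3 / 2 : ℝ)) :=
    ((summable_nat_add_iff (f := fun k : ℕ => 1 / (k : ℝ) ^ (3 / 2 : ℝ)) 1).2
      (Real.summable_one_div_nat_rpow.2 (by norm_num))).mul_left _
  refine Summable.of_nonneg_of_le (fun k => by positivity) (fun k => ?_) h1
  have hk : (0 : ℝ) < (k : ℝ) + 1 := by positivity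
  have h2 : ((k : ℝ) + 1) ^ (3 / 2 : ℝ) * √((k : ℝ) + 1) = ((k : ℝ) + 1) ^ 2 := by
    rw [Real.sqrt_eq_rpow, ← Real.rpow_add hk, ← Real.rpow_natCast]
    norm_num
  push_cast
  calc α k ^ 2 / (q / √((k : ℝ) + 1)) ≤ (c / (k + 1)) ^ 2 / (q / √((k : ℝ) + 1)) := by
        gcongr
        · exact hα k
        · exact h k
    _ = c ^ 2 / q * (1 / ((k : ℝ) + 1) ^ (3 / 2 : ℝ)) := by
        rw [div_pow, ← h2]
        have := Real.rpow_pos_of_pos hk (3 / 2)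
        field_simp

end Sequences

/-! ### Measurability of the derived quantities. -/

section Measurability

variable {m n : ℕ} {Ω : Type*} [MeasurableSpace Ω]

theorem measurable_averageEstimate :
    Measurable (averageEstimate : NetState m n → EuclideanSpace ℝ (Fin n)) := by
  unfold averageEstimate
  fun_prop

theorem measurable_disagreement : Measurable (disagreement : NetState m n → ℝ) := by
  have := measurable_averageEstimate (m := m) (n := n)
  unfold disagreement
  fun_prop

theorem Measurable.mixedEstimate {M : Ω → Matrix (Fin m) (Fin m) ℝ} {Z : Ω → NetState m n}
    (hM : ∀ i j, Measurable fun ω => M ω i j) (hZ : Measurable Z) (i : Fin m) :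
    Measurable fun ω => mixedEstimate (M ω) (Z ω) i := by
  unfold _root_.mixedEstimate
  exact Finset.measurable_sum _ fun j _ => (hM i j).smul ((measurable_pi_apply j).comp hZ)

theorem noiseHistory_le {Ω' : Type*} [MeasurableSpace Ω'] {ξ : ℕ → Ω → Ω'}
    (hξ : ∀ k, Measurable (ξ k)) (k : ℕ) : noiseHistory ξ k ≤ ‹MeasurableSpace Ω› :=
  iSup₂_le fun j _ => (hξ j).comap_le

end Measurability

/-! ### Tonelli and conditioning. -/

section Probability

variable {Ω : Type*} {mΩ : MeasurableSpace Ω} {P : Measure Ω}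

theorem ae_summable_of_summable_integral {F : ℕ → Ω → ℝ} (hF : ∀ k ω, 0 ≤ F k ω)
    (hint : ∀ k, Integrable (F k) P) (h : Summable fun k => ∫ ω, F k ω ∂P) :
    ∀ᵐ ω ∂P, Summable fun k => F k ω := by
  have hmeas : ∀ k, AEMeasurable (fun ω => ENNReal.ofReal (F k ω)) P :=
    fun k => (hint k).aemeasurable.ennreal_ofReal
  have hfin : ∫⁻ ω, ∑' k, ENNReal.ofReal (F k ω) ∂P ≠ ⊤ := by
    rw [lintegral_tsum hmeas]
    simp_rw [← ofReal_integral_eq_lintegral_ofReal (hint _) (ae_of_all _ (hF _))]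
    exact h.tsum_ofReal_ne_top
  filter_upwards [ae_lt_top' (AEMeasurable.tsum hmeas) hfin] with ω hω
  simpa [ENNReal.toReal_ofReal (hF _ ω)] using ENNReal.summable_toReal hω.ne

/-- Since `g` is known given `𝓖`, it can be pulled out of the conditional expectation of the
indicator of `s`. -/
theorem mul_integral_le_integral_indicator {Ω : Type*} {𝓖 mΩ : MeasurableSpace Ω} {P : Measure Ω}
    [IsProbabilityMeasure P] (h𝓖 : 𝓖 ≤ mΩ) {s : Set Ω}
    (hs : MeasurableSet s) {g : Ω → ℝ} (hg : StronglyMeasurable[𝓖] g) (hg0 : ∀ ω, 0 ≤ g ω)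
    (hint : Integrable g P) {q : ℝ} (hq : ∀ᵐ ω ∂P, q ≤ (P⟦s | 𝓖⟧) ω) :
    q * ∫ ω, g ω ∂P ≤ ∫ ω, s.indicator g ω ∂P := by
  have h1 : s.indicator g = s.indicator (fun _ => (1 : ℝ)) * g := by
    ext ω
    by_cases hω : ω ∈ s <;> simp [hω]
  have hint1 : Integrable (s.indicator (fun _ => (1 : ℝ)) * g) P := h1 ▸ hint.indicator hs
  have h2 := condExp_mul_of_stronglyMeasurable_right hg hint1
    ((integrable_const (1 : ℝ)).indicator hs)
  rw [← integral_const_mul, h1, ← integral_condExp h𝓖 (f := s.indicator _ * g)]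
  refine integral_mono_ae (hint.const_mul q) integrable_condExp ?_
  filter_upwards [h2, hq] with ω h2 hq
  rw [h2]
  exact mul_le_mul_of_nonneg_right hq (hg0 ω)

end Probability

/-! ### Expected contraction in one mixing step. -/

section OneStep

variable {m n : ℕ} {Ω : Type*} [MeasurableSpace Ω] {P : Measure Ω} [IsProbabilityMeasure P]

theorem integrable_disagreement {Z : Ω → NetState m n} (hZ : Measurable Z) {R : ℝ}
    (hR : ∀ᵐ ω ∂P, ∀ i, ‖Z ω i‖ ≤ R) : Integrable (fun ω => disagreement (Z ω)) P := by
  refine Integrable.of_bound (measurable_disagreement.comp hZ).aestronglyMeasurable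
    (∑ _i : Fin m, R ^ 2) ?_
  filter_upwards [hR] with ω hω
  rw [Real.norm_of_nonneg (disagreement_nonneg _)]
  refine (disagreement_le_sum_norm_sub_sq (Z ω) 0).trans (Finset.sum_le_sum fun i _ => ?_)
  rw [sub_zero]
  exact pow_le_pow_left₀ (norm_nonneg _) (hω i) 2

theorem integrable_norm_sub_sq {Z : Ω → NetState m n} (hZ : Measurable Z) {R : ℝ}
    (hR : ∀ᵐ ω ∂P, ∀ i, ‖Z ω i‖ ≤ R) (i j : Fin m) :
    Integrable (fun ω => ‖Z ω i - Z ω j‖ ^ 2) P := by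
  refine Integrable.of_bound (by fun_prop) ((R + R) ^ 2) ?_
  filter_upwards [hR] with ω hω
  rw [Real.norm_of_nonneg (sq_nonneg _)]
  exact pow_le_pow_left₀ (norm_nonneg _)
    ((norm_sub_le _ _).trans (add_le_add (hω i) (hω j))) 2

theorem integrable_sum_norm_mixedEstimate_sub_sq {Z : Ω → NetState m n} (hZ : Measurable Z) {R : ℝ}
    (hR : ∀ᵐ ω ∂P, ∀ i, ‖Z ω i‖ ≤ R) {M : Ω → Matrix (Fin m) (Fin m) ℝ}
    (hM : ∀ i j, Measurable fun ω => M ω i j)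
    (hMs : ∀ᵐ ω ∂P, M ω ∈ doublyStochastic ℝ (Fin m)) :
    Integrable (fun ω => ∑ l, ‖mixedEstimate (M ω) (Z ω) l - averageEstimate (Z ω)‖ ^ 2) P := by
  have h1 := fun l => Measurable.mixedEstimate hM hZ l
  have h2 := measurable_averageEstimate.comp hZ
  refine Integrable.of_bound
    (Finset.measurable_sum _ fun l _ => ((h1 l).sub h2).norm.pow_const 2).aestronglyMeasurable
    (∑ _i : Fin m, (R + R) ^ 2) ?_
  filter_upwards [hR, hMs] with ω hω hs
  rw [Real.norm_of_nonneg (Finset.sum_nonneg fun _ _ => sq_nonneg _)]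
  refine Finset.sum_le_sum fun i _ => pow_le_pow_left₀ (norm_nonneg _)
    ((norm_sub_le _ _).trans (add_le_add (norm_mixedEstimate_le hs hω i) ?_)) 2
  have hm : (0 : ℝ) < m := by exact_mod_cast i.pos
  rw [averageEstimate, norm_smul, Real.norm_of_nonneg (by positivity), one_div_mul_eq_div,
    div_le_iff₀ hm]
  calc _ ≤ ∑ j, ‖Z ω j‖ := norm_sum_le _ _
    _ ≤ ∑ _j : Fin m, R := Finset.sum_le_sum fun j _ => hω j
    _ = R * m := by simp [mul_comm]

/-- One mixing step with random doubly stochastic weights contracts the expected disagreement. -/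
theorem integral_sum_norm_mixedEstimate_sub_sq_le {Z : Ω → NetState m n} (hZ : Measurable Z) {R : ℝ}
    (hR : ∀ᵐ ω ∂P, ∀ i, ‖Z ω i‖ ≤ R) {M : Ω → Matrix (Fin m) (Fin m) ℝ}
    (hM : ∀ i j, Measurable fun ω => M ω i j)
    (hMs : ∀ᵐ ω ∂P, M ω ∈ doublyStochastic ℝ (Fin m)) {γ : ℝ} (hγ : 0 < γ)
    (hMγ : ∀ᵐ ω ∂P, ∀ i, γ ≤ M ω i i) {G : Digraph (Fin m)} {q : ℝ} (hq : 0 ≤ q)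
    (hG : ∀ i j, G.Adj j i → ∀ᵐ ω ∂P,
      q ≤ (P⟦{ω' | γ ≤ M ω' i j} | MeasurableSpace.comap Z inferInstance⟧) ω)
    {N : ℝ} (hN : 0 < N) (hNG : ∀ z : NetState m n, disagreement z ≤ N * edgeEnergy G z) :
    ∫ ω, ∑ l, ‖mixedEstimate (M ω) (Z ω) l - averageEstimate (Z ω)‖ ^ 2 ∂P ≤
      (1 - γ / (2 * N * (m * m + 1)) * q) * ∫ ω, disagreement (Z ω) ∂P := by
  classical
  have hV := integrable_disagreement hZ hR
  have hS := integrable_sum_norm_mixedEstimate_sub_sq hZ hR hM hMs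
  set V := ∫ ω, disagreement (Z ω) ∂P
  set S := ∫ ω, ∑ l, ‖mixedEstimate (M ω) (Z ω) l - averageEstimate (Z ω)‖ ^ 2 ∂P
  have hD := fun i j => integrable_norm_sub_sq hZ hR i j
  have hms : ∀ i j, MeasurableSet {ω | γ ≤ M ω i j} := fun i j =>
    measurableSet_le measurable_const (hM i j)
  have step : ∀ i j, S + γ / 2 * ∫ ω, {ω | γ ≤ M ω i j}.indicator
      (fun ω => ‖Z ω i - Z ω j‖ ^ 2) ω ∂P ≤ V := by
    intro i j
    rw [← integral_const_mul, ← integral_add hS (((hD i j).indicator (hms i j)).const_mul _)]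
    refine integral_mono_ae (hS.add (((hD i j).indicator (hms i j)).const_mul _)) hV ?_
    filter_upwards [hMs, hMγ] with ω hs hi
    exact sum_norm_mixedEstimate_sub_sq_add_le hs (Z ω) (averageEstimate (Z ω)) hγ.le (hi i) j
  have edge : ∀ i j, G.Adj j i → γ / 2 * q * ∫ ω, ‖Z ω i - Z ω j‖ ^ 2 ∂P ≤ V - S := by
    intro i j hij
    have hcomap : Measurable[MeasurableSpace.comap Z inferInstance]
        fun ω => ‖Z ω i - Z ω j‖ ^ 2 := by
      have : Measurable fun z : NetState m n => ‖z i - z j‖ ^ 2 := by fun_prop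
      exact this.comp (comap_measurable Z)
    have h1 := mul_integral_le_integral_indicator hZ.comap_le (hms i j)
      hcomap.stronglyMeasurable (fun ω => sq_nonneg _) (hD i j) (hG i j hij)
    have h2 := mul_le_mul_of_nonneg_left h1 (half_pos hγ).le
    linarith [step i j]
  have hSV : S ≤ V := by
    refine integral_mono_ae hS hV ?_
    filter_upwards [hMs, hMγ] with ω hs hi
    rcases isEmpty_or_nonempty (Fin m) with hm | ⟨⟨i⟩⟩
    · simp [disagreement]
    · refine le_trans ?_ (sum_norm_mixedEstimate_sub_sq_add_le hs (Z ω)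
        (averageEstimate (Z ω)) hγ.le (hi i) i)
      simp
  have henergy : V ≤ N * ∑ p : Fin m × Fin m with G.Adj p.2 p.1,
      ∫ ω, ‖Z ω p.1 - Z ω p.2‖ ^ 2 ∂P := by
    rw [← integral_finsetSum _ fun p _ => hD p.1 p.2, ← integral_const_mul]
    refine integral_mono hV ((integrable_finsetSum _ fun p _ => hD p.1 p.2).const_mul N)
      fun ω => ?_
    refine (hNG (Z ω)).trans_eq ?_
    unfold edgeEnergy
    congr!
  -- There are at most `m * m` edges, each with the same bound `V - S`; the extra `1` keeps the
  -- denominator positive when `m = 0`.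
  have hsum : γ / 2 * q * ∑ p : Fin m × Fin m with G.Adj p.2 p.1,
      ∫ ω, ‖Z ω p.1 - Z ω p.2‖ ^ 2 ∂P ≤ (m * m + 1) * (V - S) := by
    rw [Finset.mul_sum]
    refine (Finset.sum_le_card_nsmul _ _ (V - S) fun p hp =>
      edge p.1 p.2 (Finset.mem_filter.1 hp).2).trans ?_
    rw [nsmul_eq_mul]
    refine mul_le_mul_of_nonneg_right ?_ (sub_nonneg.2 hSV)
    have : (Finset.univ.filter fun p : Fin m × Fin m => G.Adj p.2 p.1).card ≤ m * m := by
      simpa using Finset.card_filter_le (Finset.univ : Finset (Fin m × Fin m))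
        fun p => G.Adj p.2 p.1
    have : ((Finset.univ.filter fun p : Fin m × Fin m => G.Adj p.2 p.1).card : ℝ) ≤ m * m := by
      exact_mod_cast this
    linarith
  have h3 := mul_le_mul_of_nonneg_left henergy (mul_nonneg (half_pos hγ).le hq)
  have h4 := mul_le_mul_of_nonneg_left hsum hN.le
  have h5 : γ / (2 * N * (m * m + 1)) * q * V ≤ V - S := by
    rw [div_mul_eq_mul_div, div_mul_eq_mul_div, div_le_iff₀ (by positivity)]
    nlinarith
  linarith

end OneStep

/-! ### Pathwise estimates for the algorithm. -/

namespace IsProjectedSubgradientMethod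

variable {m n : ℕ} {Ω Ω' : Type*} [MeasurableSpace Ω']
  {f : Fin m → EuclideanSpace ℝ (Fin n) → ℝ} {X : Fin m → Set (EuclideanSpace ℝ (Fin n))}
  {α : ℕ → ℝ} {ψ : NetState m n → Ω' → Matrix (Fin m) (Fin m) ℝ} {ξ : ℕ → Ω → Ω'}
  {x₀ : NetState m n} {x : ℕ → Ω → NetState m n} {A : ℕ → Ω → Matrix (Fin m) (Fin m) ℝ}
  {d : ℕ → Ω → NetState m n}

theorem state_mem (hx : IsProjectedSubgradientMethod f X α ψ ξ x₀ x A d)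
    (hc : ∀ i, IsClosed (X i)) (k : ℕ) (ω : Ω) (i : Fin m) : x k ω i ∈ X i := by
  cases k with
  | zero => rw [hx.init_eq]; exact hx.init_mem i
  | succ k => rw [hx.update]; exact (euclProj_spec (hc i) ⟨_, hx.init_mem i⟩ _).1

theorem measurable_weights [MeasurableSpace Ω]
    (hx : IsProjectedSubgradientMethod f X α ψ ξ x₀ x A d)
    (hψ : ∀ i j, Measurable fun q : NetState m n × Ω' => ψ q.1 q.2 i j)
    (hξ : ∀ k, Measurable (ξ k)) {k : ℕ} (hk : Measurable (x k)) (i j : Fin m) :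
    Measurable fun ω => A k ω i j := by
  simp only [hx.comm_eq]
  exact (hψ i j).comp (hk.prodMk (hξ k))

theorem measurable_state [MeasurableSpace Ω]
    (hx : IsProjectedSubgradientMethod f X α ψ ξ x₀ x A d)
    (hψ : ∀ i j, Measurable fun q : NetState m n × Ω' => ψ q.1 q.2 i j)
    (hξ : ∀ k, Measurable (ξ k)) (hc : ∀ i, IsClosed (X i)) (hv : ∀ i, Convex ℝ (X i)) (k : ℕ) :
    Measurable (x k) := by
  induction k with
  | zero =>
    have : x 0 = fun _ => x₀ := funext hx.init_eq
    rw [this]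
    exact measurable_const
  | succ k ih =>
    refine measurable_pi_iff.2 fun i => ?_
    simp only [hx.update]
    have hd : Measurable (d k) := (hx.nonanticipating k).mono (noiseHistory_le hξ k) le_rfl
    exact (continuous_euclProj (hc i) (hv i) ⟨_, hx.init_mem i⟩).measurable.comp
      ((Measurable.mixedEstimate (hx.measurable_weights hψ hξ ih) ih i).sub
        (((measurable_pi_apply i).comp hd).const_smul (α k)))

/-- As the constraint set is common and convex, the mixed estimate already lies in it, so projecting
after a step of length at most `L * α k` moves it by at most twice that length. -/
theorem norm_state_succ_sub_mixedEstimate_le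
    (hx : IsProjectedSubgradientMethod f X α ψ ξ x₀ x A d) {Y : Set (EuclideanSpace ℝ (Fin n))}
    (hc : IsClosed Y) (hv : Convex ℝ Y) (hXY : ∀ i, X i = Y) (hα : ∀ k, 0 ≤ α k) {L : ℝ}
    (hL : ∀ i x, ∀ s ∈ subgradients (f i) x, ‖s‖ ≤ L) {k : ℕ} {ω : Ω}
    (hA : A k ω ∈ doublyStochastic ℝ (Fin m)) (i : Fin m) :
    ‖x (k + 1) ω i - mixedEstimate (A k ω) (x k ω) i‖ ≤ 2 * L * α k := by
  have hmem : ∀ i, x k ω i ∈ Y := fun i =>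
    hXY i ▸ hx.state_mem (fun i => (hXY i).symm ▸ hc) k ω i
  have h1 := norm_euclProj_sub_le_of_mem hc (mixedEstimate_mem hA hv hmem i)
    (mixedEstimate (A k ω) (x k ω) i - α k • d k ω i)
  rw [sub_sub_cancel_left, norm_neg, norm_smul, Real.norm_of_nonneg (hα k)] at h1
  rw [hx.update, hXY i]
  have h2 := mul_le_mul_of_nonneg_left (hL i _ _ (hx.subgrad k ω i)) (hα k)
  linarith

theorem norm_state_le
    (hx : IsProjectedSubgradientMethod f X α ψ ξ x₀ x A d) {Y : Set (EuclideanSpace ℝ (Fin n))}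
    (hc : IsClosed Y) (hv : Convex ℝ Y) (hXY : ∀ i, X i = Y) (hα : ∀ k, 0 ≤ α k) {L : ℝ}
    (hL : ∀ i x, ∀ s ∈ subgradients (f i) x, ‖s‖ ≤ L) {ω : Ω}
    (hA : ∀ k, A k ω ∈ doublyStochastic ℝ (Fin m)) (k : ℕ) (i : Fin m) :
    ‖x k ω i‖ ≤ ∑ j, ‖x₀ j‖ + ∑ l ∈ Finset.range k, 2 * L * α l := by
  induction k generalizing i with
  | zero =>
    rw [hx.init_eq, Finset.sum_range_zero, add_zero]
    exact Finset.single_le_sum (f := fun j => ‖x₀ j‖) (fun _ _ => norm_nonneg _)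
      (Finset.mem_univ i)
  | succ k ih =>
    have h1 := norm_mixedEstimate_le (hA k) ih i
    have h2 := hx.norm_state_succ_sub_mixedEstimate_le hc hv hXY hα hL (hA k) i
    have h3 := norm_le_norm_add_norm_sub' (x (k + 1) ω i) (mixedEstimate (A k ω) (x k ω) i)
    rw [Finset.sum_range_succ]
    linarith

theorem disagreement_succ_le
    (hx : IsProjectedSubgradientMethod f X α ψ ξ x₀ x A d) {Y : Set (EuclideanSpace ℝ (Fin n))}
    (hc : IsClosed Y) (hv : Convex ℝ Y) (hXY : ∀ i, X i = Y) (hα : ∀ k, 0 ≤ α k) {L : ℝ}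
    (hL : ∀ i x, ∀ s ∈ subgradients (f i) x, ‖s‖ ≤ L) {k : ℕ} {ω : Ω}
    (hA : A k ω ∈ doublyStochastic ℝ (Fin m)) {θ : ℝ} (hθ : 0 < θ) :
    disagreement (x (k + 1) ω) ≤
      (1 + θ) * ∑ l, ‖mixedEstimate (A k ω) (x k ω) l - averageEstimate (x k ω)‖ ^ 2 +
        (1 + 1 / θ) * (m * (2 * L * α k) ^ 2) := by
  refine (disagreement_le_sum_norm_sub_sq _ (averageEstimate (x k ω))).trans ?_
  simpa using sum_norm_sub_sq_le_of_norm_sub_le (x (k + 1) ω)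
    (mixedEstimate (A k ω) (x k ω)) (averageEstimate (x k ω)) hθ
    fun i => hx.norm_state_succ_sub_mixedEstimate_le hc hv hXY hα hL hA i

end IsProjectedSubgradientMethod

/-! ### Decay in expectation and almost sure consensus. -/

theorem mainTheorem6 {m n : ℕ} {Ω Ω' : Type*} [MeasurableSpace Ω] [MeasurableSpace Ω']
    (P : Measure Ω) [IsProbabilityMeasure P]
    (f : Fin m → EuclideanSpace ℝ (Fin n) → ℝ)
    (X : Fin m → Set (EuclideanSpace ℝ (Fin n)))
    (α : ℕ → ℝ)
    (ψ : NetState m n → Ω' → Matrix (Fin m) (Fin m) ℝ)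
    (ξ : ℕ → Ω → Ω')
    (G : Digraph (Fin m)) (γ δ K C : ℝ)
    (x₀ : NetState m n)
    (x : ℕ → Ω → NetState m n)
    (A : ℕ → Ω → Matrix (Fin m) (Fin m) ℝ)
    (d : ℕ → Ω → NetState m n)
    (hγ : 0 < γ) (hδ : 0 < δ) (hδ' : δ ≤ 1) (hK : 0 < K) (hC : 0 < C)
    (hα : ∀ k, 0 < α k)
    (hf : ∀ i, ConvexOn ℝ Set.univ (f i))
    (hψ : ∀ i j, Measurable fun q : NetState m n × Ω' => ψ q.1 q.2 i j)
    (hξ : ∀ k, Measurable (ξ k))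
    (hξ_indep : iIndepFun ξ P)
    (hx : IsProjectedSubgradientMethod f X α ψ ξ x₀ x A d)
    (h_comm : DistanceDependentCommunication P G γ δ K C x A)
    (h_subgrad : BoundedSubgradients f)
    (h_conn : StronglyConnectedDigraph G)
    (h_stoch : DoublyStochasticWeights P A)
    (h_self : SelfConfidence P γ A)
    (h_same : IdenticalConstraintSets X)
    (h_step : LimitingStepsizes α) :
    ∀ i : Fin m,
      (∀ᵐ ω ∂P, Summable fun k : ℕ => α k * ‖x k ω i - averageEstimate (x k ω)‖) ∧
      (∀ᵐ ω ∂P, Tendsto (fun k : ℕ => ‖x k ω i - averageEstimate (x k ω)‖) atTop (𝓝 0)) := by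
  obtain ⟨Y, hc, hv, hXY⟩ := h_same
  obtain ⟨L, hL0, hL⟩ := h_subgrad
  have hα0 : ∀ k, 0 ≤ α k := fun k => (hα k).le
  have hxm := hx.measurable_state hψ hξ (fun i => (hXY i).symm ▸ hc) (fun i => (hXY i).symm ▸ hv)
  have hAm := fun k => hx.measurable_weights hψ hξ (hxm k)
  have hA : ∀ᵐ ω ∂P, ∀ k, A k ω ∈ doublyStochastic ℝ (Fin m) := ae_all_iff.2 h_stoch
  have hself : ∀ k, ∀ᵐ ω ∂P, ∀ i, γ ≤ A k ω i i := fun k => ae_all_iff.2 (h_self k)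
  obtain ⟨N, hN0, hN⟩ := exists_disagreement_le_mul_edgeEnergy (n := n) h_conn
  -- The estimates stay in balls of slowly growing deterministic radius.
  obtain ⟨c, hc0, hαc⟩ := exists_le_div_of_tendsto_mul (α := α) (by
    simpa using h_step 0 one_pos)
  -- The distance of two estimates is at most twice the radius `∑ ‖x₀ j‖ + ∑ 2 * L * α l`, whence
  -- the doubled constants.
  obtain ⟨B, hB0, hB⟩ := exists_add_sum_range_le_mul_rpow (α := fun k => 4 * L * α k)
    (c := 4 * L * c) (by positivity) (fun k => by
      rw [mul_div_assoc]
      exact mul_le_mul_of_nonneg_left (hαc k) (by positivity))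
    (ε := 1 / (2 * C)) (by positivity) (2 * ∑ j, ‖x₀ j‖)
  obtain ⟨q, hq0, hq⟩ := exists_div_sqrt_le_commLowerBound hδ hK hC hB0
  have hbound : ∀ᵐ ω ∂P, ∀ k i,
      ‖x k ω i‖ ≤ ∑ j, ‖x₀ j‖ + ∑ l ∈ Finset.range k, 2 * L * α l := by
    filter_upwards [hA] with ω hω k i
    exact hx.norm_state_le hc hv hXY hα0 hL hω k i
  have hbound' : ∀ k, ∀ᵐ ω ∂P, ∀ i,
      ‖x k ω i‖ ≤ ∑ j, ‖x₀ j‖ + ∑ l ∈ Finset.range k, 2 * L * α l := ae_all_iff.1 hbound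
  have hprob : ∀ (k : ℕ) i j, G.Adj j i → ∀ᵐ ω ∂P, q / √((k : ℝ) + 1) ≤
      (P⟦{ω' | γ ≤ A k ω' i j} | MeasurableSpace.comap (x k) inferInstance⟧) ω := by
    intro k i j hij
    filter_upwards [h_comm i j hij k, hbound' k] with ω h1 h2
    refine (hq k _ (norm_nonneg _) (le_trans ?_ (hB k))).trans h1
    refine (norm_sub_le _ _).trans ((add_le_add (h2 i) (h2 j)).trans_eq ?_)
    have : ∀ l, 4 * L * α l = 2 * (2 * L * α l) := fun l => by ring
    simp only [this, ← Finset.mul_sum]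
    ring
  -- The contraction rates.
  set τ := γ / (2 * N * (m * m + 1)) * q / 2 with hτ
  have hτ0 : 0 < τ := by positivity
  set θ : ℕ → ℝ := fun k => τ / √((k : ℝ) + 1) with hθ
  have hθ0 : ∀ k, 0 < θ k := fun k => by positivity
  have hθτ : ∀ k, θ k ≤ τ := fun k =>
    div_le_self hτ0.le (Real.one_le_sqrt.2 (by linarith [(Nat.cast_nonneg k : (0 : ℝ) ≤ k)]))
  have hαθ : Summable fun k => α k ^ 2 / θ k := summable_sq_div_of_le hα0 hαc hτ0
  set b : ℕ → ℝ := fun k => (τ + 1) * (m * (2 * L) ^ 2) * (α k ^ 2 / θ k) with hb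
  have hb0 : ∀ k, 0 ≤ b k := fun k => by have := hθ0 k; positivity
  have hbsum : Summable b := hαθ.mul_left _
  have hble : ∀ k, (1 + 1 / θ k) * (m * (2 * L * α k) ^ 2) ≤ b k := by
    intro k
    have h1 : 1 + 1 / θ k ≤ (τ + 1) / θ k := by
      rw [add_div]
      exact add_le_add_left ((one_le_div (hθ0 k)).2 (hθτ k)) _
    calc _ ≤ (τ + 1) / θ k * (m * (2 * L * α k) ^ 2) :=
          mul_le_mul_of_nonneg_right h1 (by positivity)
      _ = b k := by simp only [hb]; ring
  have hVint := fun k => integrable_disagreement (hxm k) (hbound' k)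
  have hSint := fun k => integrable_sum_norm_mixedEstimate_sub_sq (hxm k) (hbound' k) (hAm k)
    (h_stoch k)
  -- The expected disagreement.
  have hW : ∀ k, ∫ ω, disagreement (x (k + 1) ω) ∂P ≤
      (1 - θ k) * ∫ ω, disagreement (x k ω) ∂P + b k := by
    intro k
    have h1 := integral_sum_norm_mixedEstimate_sub_sq_le (hxm k) (hbound' k) (hAm k) (h_stoch k)
      hγ (hself k) (by positivity) (hprob k) hN0 hN
    have h2 : ∫ ω, disagreement (x (k + 1) ω) ∂P ≤ ∫ ω, ((1 + θ k) *
        ∑ l, ‖mixedEstimate (A k ω) (x k ω) l - averageEstimate (x k ω)‖ ^ 2 + b k) ∂P := by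
      refine integral_mono_ae (hVint (k + 1)) (((hSint k).const_mul _).add
        (integrable_const _)) ?_
      filter_upwards [hA] with ω hω
      exact (hx.disagreement_succ_le hc hv hXY hα0 hL (hω k) (hθ0 k)).trans
        (add_le_add_right (hble k) _)
    rw [integral_add ((hSint k).const_mul _) (integrable_const _), integral_const_mul] at h2
    simp only [integral_const, probReal_univ, one_smul] at h2
    have h3 : γ / (2 * N * (m * m + 1)) * (q / √((k : ℝ) + 1)) = 2 * θ k := by
      simp only [hθ, hτ]
      ring
    rw [h3] at h1
    have h4 := mul_le_mul_of_nonneg_left h1 (add_pos one_pos (hθ0 k)).le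
    have h5 : 0 ≤ ∫ ω, disagreement (x k ω) ∂P :=
      integral_nonneg fun ω => disagreement_nonneg _
    -- `τ` is half the contraction constant, so mixing gains `2 * θ k` and the perturbation costs `θ
    -- k`: `(1 + θ) * (1 - 2 * θ) ≤ 1 - θ`.
    nlinarith [mul_nonneg (sq_nonneg (θ k)) h5, mul_nonneg (hθ0 k).le h5]
  have hWsum := summable_mul_of_le_one_sub_mul_add
    (fun k => integral_nonneg fun ω => disagreement_nonneg (x k ω)) (fun k => (hθ0 k).le)
    hb0 hbsum hW
  have hVsum : ∀ᵐ ω ∂P, Summable fun k => θ k * disagreement (x k ω) := by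
    refine ae_summable_of_summable_integral
      (fun k ω => mul_nonneg (hθ0 k).le (disagreement_nonneg _))
      (fun k => (hVint k).const_mul _) ?_
    simpa only [integral_const_mul] using hWsum
  refine fun i => ⟨?_, ?_⟩
  · filter_upwards [hVsum] with ω hω
    refine Summable.of_nonneg_of_le (fun k => mul_nonneg (hα0 k) (norm_nonneg _)) (fun k => ?_)
      (hαθ.add hω)
    have h1 := mul_le_mul_of_nonneg_left (norm_sub_averageEstimate_sq_le (x k ω) i) (hθ0 k).le
    refine le_trans ?_ (add_le_add_right h1 _)
    set t := ‖x k ω i - averageEstimate (x k ω)‖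
    have h2 : α k ^ 2 / θ k + θ k * t ^ 2 - α k * t =
        (α k - θ k * t) ^ 2 / θ k + α k * t := by
      have := (hθ0 k).ne'
      field_simp
      ring
    have h3 : 0 ≤ (α k - θ k * t) ^ 2 / θ k + α k * t :=
      add_nonneg (div_nonneg (sq_nonneg _) (hθ0 k).le) (mul_nonneg (hα0 k) (norm_nonneg _))
    linarith
  · filter_upwards [hVsum, hA, ae_all_iff.2 hself] with ω hω hAω hsω
    have hlim : Tendsto (fun k => disagreement (x k ω)) atTop (𝓝 0) := by
      -- The summable increment is `θ k * V k + b k`: pathwise, mixing is only known not to increase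
      -- `V`.
      refine tendsto_zero_of_le_add_of_summable_mul (fun k => disagreement_nonneg _)
        (fun k => (hθ0 k).le) (hω.add hbsum) (fun k => ?_) hω (not_summable_div_sqrt hτ0)
      have h1 := hx.disagreement_succ_le hc hv hXY hα0 hL (hAω k) (hθ0 k)
      -- The choice `j = i` makes the gain vanish and leaves plain monotonicity.
      have h2 := sum_norm_mixedEstimate_sub_sq_add_le (hAω k) (x k ω)
        (averageEstimate (x k ω)) hγ.le (hsω k i) i
      simp only [sub_self, norm_zero, ne_eq, OfNat.ofNat_ne_zero, not_false_eq_true, zero_pow,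
        indicator_zero, mul_zero, add_zero] at h2
      have h3 := mul_le_mul_of_nonneg_left h2 (add_pos one_pos (hθ0 k)).le
      change _ ≤ (1 + θ k) * disagreement (x k ω) at h3
      linarith [hble k]
    have hsq := squeeze_zero (fun k => sq_nonneg _)
      (fun k => norm_sub_averageEstimate_sq_le (x k ω) i) hlim
    simpa [Real.sqrt_sq (norm_nonneg _)] using hsq.sqrt
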